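/- Let $F=\{f_k:k\ge 0\}$ and $G=\{g_k:k\ge 0\}$ be probability distributions on the nonnegative integers with common finite mean $\mu>0$. Assume there are $\alpha,\beta>1$ and functions $L_F,L_G$ that are slowly varying at infinity (i.e. $\lim_{x\to\infty}L(tx)/L(x)=1$ for every fixed $t>0$) such that $$\sum_{k>x} f_k\le x^{-\alpha}L_F(x),\qquad \sum_{k>x} g_k\le x^{-\beta}L_G(x)\qquad\text{for all } x>0.$$ Put $\kappa=\min\{1-\alpha^{-1},\,1-\beta^{-1},\,1/2\}$ and fix $0<\delta_0<\kappa$. For each $n$ construct a pair of random sequences $(\mathbf N,\mathbf D)=((N_1,\dots,N_n),(D_1,\dots,D_n))$ as follows. 1. Sample $\gamma_1,\dots,\gamma_n$ i.i.d. from $F$ and, independently, $\xi_1,\dots,\xi_n$ i.i.d. from $G$, and let $\Delta_n=\sum_{i=1}^n\gamma_i-\sum_{i=1}^n\xi_i$. 2. If $|\Delta_n|\le n^{1-\kappa+\delta_0}$, go to step 3; otherwise repeat step 1 with fresh independent samples. 3. Choose $|\Delta_n|$ of the $n$ indices uniformly at random without replacement, independently of the samples given $\Delta_n$. If $\Delta_n\ge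 0$, let $N_i=\gamma_i$ for all $i$, let $D_i=\xi_i+1$ for the chosen indices $i$ and $D_i=\xi_i$ for the others. If $\Delta_n<0$, let $D_i=\xi_i$ for all $i$, let $N_i=\gamma_i+1$ for the chosen indices $i$ and $N_i=\gamma_i$ for the others. Call $(\mathbf N,\mathbf D)$ graphical if there is a simple directed graph on $n$ nodes $v_1,\dots,v_n$ (no loops, at most one edge in each direction between any two nodes) in which $v_i$ has in-degree $N_i$ and out-degree $D_i$ for every $i$. Then $$\lim_{n\to\infty}P\big(\text{the construction terminates and } (\mathbf N,\mathbf D)\text{ is graphical}\big)=1.$$ -/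

import Mathlib

open MeasureTheory Filter Topology

/-- `L` is slowly varying at infinity: `L (t x) / L x → 1` as `x → ∞`, for every fixed `t > 0`. -/
def IsSlowlyVarying (L : ℝ → ℝ) : Prop :=
  ∀ t : ℝ, 0 < t → Tendsto (fun x : ℝ => L (t * x) / L x) atTop (𝓝 1)

/-- The tail `x ↦ ∑_{k > x} f_k` of a probability distribution on the nonnegative integers. -/
noncomputable def tailProb (F : PMF ℕ) (x : ℝ) : ℝ :=
  F.toMeasure.real {k : ℕ | x < (k : ℝ)}

/-- The distribution `F` on the nonnegative integers has (finite) mean `μ`. -/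
def HasMean (F : PMF ℕ) (μ : ℝ) : Prop :=
  HasSum (fun k : ℕ => (k : ℝ) * (F k).toReal) μ

/-- The tail of `F` is majorised by a power law with index `α` and slowly varying factor `L`.
At `x = 0` the majorant `x ^ (-α) * L x` is infinite and there is nothing to require. -/
def HasPowerLawMajorant (F : PMF ℕ) (α : ℝ) (L : ℝ → ℝ) : Prop :=
  ∀ x : ℝ, 0 < x → tailProb F x ≤ x ^ (-α) * L x

/-- The pair `(m, d)` is the pair of in- and out-degree sequences of a simple directed graph on `V`:
no loops, and at most one edge in each direction (automatic, as `Digraph` is a relation). -/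
def IsGraphical {V : Type*} (m d : V → ℕ) : Prop :=
  ∃ E : Digraph V, (∀ v, ¬ E.Adj v v) ∧
    (∀ v, {w | E.Adj w v}.ncard = m v) ∧ (∀ v, {w | E.Adj v w}.ncard = d v)

namespace DegreeAlgorithm

/-- The exponent constant `κ = min {1 - 1/α, 1 - 1/β, 1/2}`. -/
noncomputable def kappa (α β : ℝ) : ℝ :=
  min (1 - α⁻¹) (min (1 - β⁻¹) (1 / 2))

/-- One sampling round: candidate in-degrees `γ` and candidate out-degrees `ξ` of the `n` nodes. -/
abbrev Sample (n : ℕ) : Type := (Fin n → ℕ) × (Fin n → ℕ)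

/-- `Δ = ∑ γ_i - ∑ ξ_i`. -/
def excess {n : ℕ} (s : Sample n) : ℤ :=
  ∑ i, (s.1 i : ℤ) - ∑ i, (s.2 i : ℤ)

/-- Acceptance test of a sampling round: `|Δ| ≤ n ^ (1 - κ + δ₀)`. -/
def Accepted (κ δ₀ : ℝ) {n : ℕ} (s : Sample n) : Prop :=
  |(excess s : ℝ)| ≤ (n : ℝ) ^ (1 - κ + δ₀)

/-- The set of the first `k` nodes in the random order `σ 0, σ 1, …, σ (n - 1)`; for a uniformly
random permutation `σ` these are `k` nodes drawn at random without replacement. -/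
def chosen {n : ℕ} (σ : Equiv.Perm (Fin n)) (k : ℕ) : Finset (Fin n) :=
  {i | ((σ.symm i : Fin n) : ℕ) < k}

/-- Correction of an accepted sample: one is added to the out-degrees (if `Δ ≥ 0`), respectively to
the in-degrees (if `Δ < 0`), of `|Δ|` chosen nodes. -/
def correct {n : ℕ} (s : Sample n) (σ : Equiv.Perm (Fin n)) : Sample n :=
  (fun i => s.1 i + if excess s < 0 ∧ i ∈ chosen σ (excess s).natAbs then 1 else 0,
   fun i => s.2 i + if 0 ≤ excess s ∧ i ∈ chosen σ (excess s).natAbs then 1 else 0)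

/-- The randomness used by the algorithm: a sample for each successive round `0, 1, 2, …`, and a
permutation of the nodes for the correction. -/
abbrev Input (n : ℕ) : Type := (ℕ → Sample n) × Equiv.Perm (Fin n)

open Classical in
/-- The output `(N, D)` of the algorithm: the first accepted sample, corrected; `none` if no round
is ever accepted (the algorithm does not terminate). -/
noncomputable def run (κ δ₀ : ℝ) {n : ℕ} (ω : Input n) : Option (Sample n) :=
  if h : ∃ r, Accepted κ δ₀ (ω.1 r) then some (correct (ω.1 (Nat.find h)) ω.2) else none

/-- The law of one sampling round: `γ_1, …, γ_n` i.i.d. with distribution `F` and, independently,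
`ξ_1, …, ξ_n` i.i.d. with distribution `G`. -/
noncomputable def sampleLaw (F G : PMF ℕ) (n : ℕ) : Measure (Sample n) :=
  (Measure.pi fun _ : Fin n => F.toMeasure).prod (Measure.pi fun _ : Fin n => G.toMeasure)

instance (F G : PMF ℕ) (n : ℕ) : IsProbabilityMeasure (sampleLaw F G n) := by
  unfold sampleLaw; infer_instance

/-- The discrete σ-algebra on the finite set of permutations. -/
instance (n : ℕ) : MeasurableSpace (Equiv.Perm (Fin n)) := ⊤

/-- The law of the randomness: independent sampling rounds, and an independent uniformly random
permutation of the nodes. -/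
noncomputable def inputLaw (F G : PMF ℕ) (n : ℕ) : Measure (Input n) :=
  (Measure.infinitePi fun _ : ℕ => sampleLaw F G n).prod
    (PMF.uniformOfFintype (Equiv.Perm (Fin n))).toMeasure

instance (F G : PMF ℕ) (n : ℕ) : IsProbabilityMeasure (inputLaw F G n) := by
  unfold inputLaw; infer_instance

/-- The event that the algorithm terminates with a graphical bi-degree-sequence `(N, D)`. -/
def graphicalEvent (κ δ₀ : ℝ) (n : ℕ) : Set (Input n) :=
  {ω | ∃ N D : Fin n → ℕ, run κ δ₀ ω = some (N, D) ∧ IsGraphical N D}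

end DegreeAlgorithm

/-! Write `a = 1 - κ + δ₀`. The choice of `κ` puts `a` strictly between max(1/α, 1/β, 1/2) and 1, so
for either tail index there is an exponent `p` in (1, 2] below that index with `a * p > 1`. The
`p`-th moment is finite, and this suffices for a law of large numbers with error `n ^ a / 2`: with
high probability no degree exceeds `n ^ a`, and the sum truncated at `n ^ a` obeys Chebyshev's
inequality. When both degree sums are that close to `n * μ`, the very first round is accepted. The
conditioning on acceptance therefore never has to be analysed.

The rest is deterministic and holds for every choice of corrected nodes. A loopless digraph exists
as soon as every pair of node sets passes a cut inequality (`isGraphical_of_cut`). It is checked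
with a threshold `n ^ b`, where `a < b < 1`. Two sets below the threshold each carry at most half of
the edges, because degrees above `n ^ c` contribute little in total and `b + c < 1`. A set above the
threshold has more elements than any degree, so the product of the two cardinalities dominates. The
lemmas that carry the argument are `isGraphical_of_threshold`, `pi_typicalSet_compl_le` and
`accepted_and_isGraphical_of_typical`. -/

/-! ### Realizing bi-degree sequences by simple digraphs -/

/-- Existence part of the Gale–Ryser type theorem for loopless digraphs, by Hall's theorem:
every ordered pair is matched either with one of the `m i` in-slots of its head or with one of the
`|V| - 1 - d j` non-edge slots of its tail. -/
theorem isGraphical_of_cut {V : Type*} [Fintype V] [DecidableEq V] (m d : V → ℕ)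
    (hsum : ∑ v, m v = ∑ v, d v) (hd : ∀ v, d v + 1 ≤ Fintype.card V)
    (hcut : ∀ A B : Finset V,
      ∑ v ∈ A, m v + ∑ v ∈ B, d v + (A ∩ B).card ≤ ∑ v, m v + A.card * B.card) :
    IsGraphical m d := by
  classical
  set N := Fintype.card V with hN
  let P := {e : V × V // e.1 ≠ e.2}
  let R := (Σ i : V, Fin (m i)) ⊕ (Σ j : V, Fin (N - 1 - d j))
  let inSlots : V → Finset R := fun i =>
    (Finset.univ : Finset (Fin (m i))).image fun s => Sum.inl ⟨i, s⟩
  let outSlots : V → Finset R := fun j =>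
    (Finset.univ : Finset (Fin (N - 1 - d j))).image fun s => Sum.inr ⟨j, s⟩
  let t : P → Finset R := fun e => inSlots e.1.2 ∪ outSlots e.1.1
  have card_off : ∀ O I : Finset V,
      ((O ×ˢ I).filter fun e => e.1 ≠ e.2).card + (O ∩ I).card = O.card * I.card := by
    intro O I
    rw [← Finset.card_product, ← Finset.card_filter_add_card_filter_not (s := O ×ˢ I)
      (fun e => e.1 ≠ e.2)]
    congr 1
    refine Finset.card_bij (fun v _ => (v, v)) ?_ ?_ ?_
    · intro v hv; simpa using hv
    · intro v _ w _ h; simpa using h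
    · rintro ⟨v, w⟩ h
      simp only [ne_eq, not_not, Finset.mem_filter, Finset.mem_product] at h
      obtain ⟨⟨h1, h2⟩, rfl⟩ := h
      exact ⟨v, by simp [h1, h2], rfl⟩
  have hall : ∀ X : Finset P, X.card ≤ (X.biUnion t).card := by
    intro X
    set I : Finset V := X.image fun e => e.1.2
    set O : Finset V := X.image fun e => e.1.1
    have h1 : X.card ≤ ((O ×ˢ I).filter fun e => e.1 ≠ e.2).card := by
      refine Finset.card_le_card_of_injOn (fun e => e.1) ?_ (Subtype.val_injective.injOn)
      intro e he
      have he' : e ∈ X := he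
      simp only [Finset.coe_filter, Set.mem_ofPred_eq, Finset.mem_product]
      exact ⟨⟨Finset.mem_image_of_mem _ he', Finset.mem_image_of_mem _ he'⟩, e.2⟩
    have h2 : ∑ i ∈ I, m i + ∑ j ∈ O, (N - 1 - d j) ≤ (X.biUnion t).card := by
      have : ∑ i ∈ I, m i + ∑ j ∈ O, (N - 1 - d j) =
          ((I.sigma fun i => (Finset.univ : Finset (Fin (m i)))).disjSum
            (O.sigma fun j => (Finset.univ : Finset (Fin (N - 1 - d j))))).card := by
        simp [Finset.card_disjSum, Finset.card_sigma]
      rw [this]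
      apply Finset.card_le_card
      rintro (⟨i, s⟩ | ⟨j, s⟩) h
      · simp only [Finset.inl_mem_disjSum, Finset.mem_sigma, Finset.mem_univ, and_true] at h
        obtain ⟨e, he, rfl⟩ := Finset.mem_image.1 h
        refine Finset.mem_biUnion.2 ⟨e, he, Finset.mem_union_left _ ?_⟩
        exact Finset.mem_image.2 ⟨s, Finset.mem_univ _, rfl⟩
      · simp only [Finset.inr_mem_disjSum, Finset.mem_sigma, Finset.mem_univ, and_true] at h
        obtain ⟨e, he, rfl⟩ := Finset.mem_image.1 h
        refine Finset.mem_biUnion.2 ⟨e, he, Finset.mem_union_right _ ?_⟩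
        exact Finset.mem_image.2 ⟨s, Finset.mem_univ _, rfl⟩
    -- Hall's condition for pairs with tails in `O` and heads in `I` is the cut inequality for `Iᶜ`
    -- and `O`, after passing to complements in the in-degree sum.
    have h3 := hcut Iᶜ O
    have h4 := card_off O I
    have h5 := Finset.sum_add_sum_compl I m
    have h6 : ∑ j ∈ O, (N - 1 - d j) + ∑ v ∈ O, d v + O.card = O.card * N := by
      rw [← Finset.sum_add_distrib, Finset.card_eq_sum_ones, ← Finset.sum_add_distrib,
        Finset.sum_mul]
      refine Finset.sum_congr rfl fun j _ => ?_
      have := hd j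
      omega
    have h7 : I.card + Iᶜ.card = N := Finset.card_add_card_compl I
    have h8 : (O ∩ I).card + (Iᶜ ∩ O).card = O.card := by
      rw [← Finset.card_union_of_disjoint]
      · congr 1; ext v; simp; tauto
      · rw [Finset.disjoint_left]; intro v; simp; tauto
    have h9 : O.card * N = O.card * I.card + Iᶜ.card * O.card := by rw [← h7]; ring
    omega
  obtain ⟨f, hf, hft⟩ := (Finset.all_card_le_biUnion_card_iff_exists_injective t).1 hall
  -- Since both degree sums agree, there are N(N - 1) slots, as many as ordered pairs. Hence the
  -- matching fills every slot, and the degrees come out exactly rather than as bounds.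
  have hcard : Fintype.card P = Fintype.card R := by
    have e1 : Fintype.card P + N = N * N := by
      have := card_off Finset.univ Finset.univ
      simp only [Finset.univ_product_univ, Finset.inter_self, Finset.card_univ] at this
      rw [Fintype.card_subtype]
      exact this
    have e2 : Fintype.card R + N = N * N := by
      have e3 : ∑ j, (N - 1 - d j) + ∑ v, d v + N = N * N := by
        conv_lhs => rw [hN, Fintype.card, Finset.card_eq_sum_ones]
        conv_rhs => rw [hN, Fintype.card, Finset.card_eq_sum_ones, Finset.sum_mul]
        rw [← Finset.sum_add_distrib, ← Finset.sum_add_distrib]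
        refine Finset.sum_congr rfl fun j _ => ?_
        have := hd j
        simp only [Finset.sum_const, Finset.card_univ, smul_eq_mul, mul_one, one_mul]
        omega
      simp only [R, Fintype.card_sum, Fintype.card_sigma, Fintype.card_fin]
      omega
    omega
  have hbij : Function.Bijective f := (Fintype.bijective_iff_injective_and_card f).2 ⟨hf, hcard⟩
  have key : ∀ e : P, (∃ s, f e = Sum.inl ⟨e.1.2, s⟩) ∨ (∃ s, f e = Sum.inr ⟨e.1.1, s⟩) := by
    intro e
    rcases Finset.mem_union.1 (hft e) with h | h
    · obtain ⟨s, -, hs⟩ := Finset.mem_image.1 h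
      exact Or.inl ⟨s, hs.symm⟩
    · obtain ⟨s, -, hs⟩ := Finset.mem_image.1 h
      exact Or.inr ⟨s, hs.symm⟩
  let E : V → V → Prop := fun v w => ∃ h : v ≠ w, ∃ s, f ⟨(v, w), h⟩ = Sum.inl ⟨w, s⟩
  have notE : ∀ v w (h : v ≠ w), ¬ E v w → ∃ s, f ⟨(v, w), h⟩ = Sum.inr ⟨v, s⟩ := by
    intro v w h hE
    rcases key ⟨(v, w), h⟩ with h' | h'
    · exact absurd ⟨h, h'⟩ hE
    · exact h'
  have hin : ∀ v (s : Fin (m v)), ∃ w, ∃ h : w ≠ v, f ⟨(w, v), h⟩ = Sum.inl ⟨v, s⟩ := by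
    intro v s
    obtain ⟨⟨⟨w, v'⟩, h⟩, he⟩ := hbij.2 (Sum.inl ⟨v, s⟩)
    rcases key ⟨(w, v'), h⟩ with ⟨s', h'⟩ | ⟨s', h'⟩
    · rw [he] at h'
      obtain rfl : v = v' := congrArg Sigma.fst (Sum.inl.inj h')
      exact ⟨w, h, he⟩
    · rw [he] at h'; cases h'
  have hout : ∀ v (s : Fin (N - 1 - d v)), ∃ w, ∃ h : v ≠ w, f ⟨(v, w), h⟩ = Sum.inr ⟨v, s⟩ := by
    intro v s
    obtain ⟨⟨⟨v', w⟩, h⟩, he⟩ := hbij.2 (Sum.inr ⟨v, s⟩)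
    rcases key ⟨(v', w), h⟩ with ⟨s', h'⟩ | ⟨s', h'⟩
    · rw [he] at h'; cases h'
    · rw [he] at h'
      obtain rfl : v = v' := congrArg Sigma.fst (Sum.inr.inj h')
      exact ⟨w, h, he⟩
  refine ⟨⟨E⟩, fun v h => h.1 rfl, fun v => ?_, fun v => ?_⟩
  · choose W hW hfW using hin v
    have hE : ∀ s, E (W s) v := fun s => ⟨hW s, s, hfW s⟩
    have : Nat.card (Fin (m v)) = Nat.card {w // E w v} := by
      refine Nat.card_congr (Equiv.ofBijective (fun s => ⟨W s, hE s⟩) ⟨?_, ?_⟩)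
      · intro s s' hs
        have hs' : W s = W s' := congrArg Subtype.val hs
        have h1 : f ⟨(W s, v), hW s⟩ = f ⟨(W s', v), hW s'⟩ := by congr 1; simp [hs']
        rw [hfW, hfW] at h1
        exact eq_of_heq (Sigma.mk.inj (Sum.inl.inj h1)).2
      · rintro ⟨w, h, s, hs⟩
        refine ⟨s, Subtype.ext ?_⟩
        have := hf (hs.trans (hfW s).symm)
        exact (Prod.ext_iff.1 (Subtype.ext_iff.1 this)).1.symm
    rw [Nat.card_fin] at this
    exact this.symm
  · choose W hW hfW using hout v
    have hE : ∀ s, v ≠ W s ∧ ¬ E v (W s) := by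
      refine fun s => ⟨hW s, ?_⟩
      rintro ⟨h, s', hs'⟩
      rw [hfW s] at hs'
      cases hs'
    have h1 : Nat.card (Fin (N - 1 - d v)) = Nat.card {w // v ≠ w ∧ ¬ E v w} := by
      refine Nat.card_congr (Equiv.ofBijective (fun s => ⟨W s, hE s⟩) ⟨?_, ?_⟩)
      · intro s s' hs
        have hs' : W s = W s' := congrArg Subtype.val hs
        have h1 : f ⟨(v, W s), hW s⟩ = f ⟨(v, W s'), hW s'⟩ := by congr 1; simp [hs']
        rw [hfW, hfW] at h1
        exact eq_of_heq (Sigma.mk.inj (Sum.inr.inj h1)).2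
      · rintro ⟨w, h, hw⟩
        obtain ⟨s, hs⟩ := notE v w h hw
        refine ⟨s, Subtype.ext ?_⟩
        have := hf (hs.trans (hfW s).symm)
        exact (Prod.ext_iff.1 (Subtype.ext_iff.1 this)).2.symm
    rw [Nat.card_fin, Nat.card_eq_fintype_card, Fintype.card_subtype] at h1
    have h2 : {w | E v w}.ncard = (Finset.univ.filter fun w => E v w).card := by
      rw [← Set.ncard_coe_finset]; simp
    have h3 : (Finset.univ.filter fun w => E v w).card +
        (Finset.univ.filter fun w => ¬ E v w).card = N :=
      Finset.card_filter_add_card_filter_not _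
    -- Non-edge slots count only nodes other than `v`. The node `v` is also a non-neighbour of
    -- itself, which accounts for the 1 in `N - 1 - d v`.
    have h4 : (Finset.univ.filter fun w => ¬ E v w) =
        insert v (Finset.univ.filter fun w => v ≠ w ∧ ¬ E v w) := by
      ext w
      simp only [Finset.mem_filter, Finset.mem_univ, true_and, Finset.mem_insert]
      constructor
      · intro h
        by_cases hvw : v = w
        · exact Or.inl hvw.symm
        · exact Or.inr ⟨hvw, h⟩
      · rintro (rfl | h)
        · exact fun h => h.1 rfl
        · exact h.2
    rw [h4, Finset.card_insert_of_notMem (by simp)] at h3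
    have h5 := hd v
    show {w | E v w}.ncard = d v
    omega

/-- A bi-degree sequence all of whose terms are below a threshold `t`, for which sets of at most
`t` nodes carry at most half of the edges, and with fewer than about `t ^ 2` edges, is graphical. -/
theorem isGraphical_of_threshold {V : Type*} [Fintype V] [DecidableEq V] (m d : V → ℕ) (t : ℝ)
    (hsum : ∑ v, m v = ∑ v, d v) (ht : 0 ≤ t)
    (hm : ∀ v, (m v : ℝ) + 1 ≤ t) (hd : ∀ v, (d v : ℝ) + 1 ≤ t)
    (hmA : ∀ A : Finset V, (A.card : ℝ) ≤ t → 2 * ∑ v ∈ A, m v ≤ ∑ v, m v)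
    (hdA : ∀ A : Finset V, (A.card : ℝ) ≤ t → 2 * ∑ v ∈ A, d v ≤ ∑ v, d v)
    (hS : ((∑ v, m v : ℕ) : ℝ) + Fintype.card V ≤ t ^ 2) :
    IsGraphical m d := by
  have hbound : ∀ (e : V → ℕ) (A B : Finset V), (∀ v, (e v : ℝ) + 1 ≤ t) → t < B.card →
      ∑ v ∈ A, e v + A.card ≤ A.card * B.card := by
    intro e A B he hB
    have h1 : ∀ v ∈ A, e v + 1 ≤ B.card := by
      intro v _
      have := (he v).trans hB.le
      exact_mod_cast this
    calc ∑ v ∈ A, e v + A.card = ∑ v ∈ A, (e v + 1) := by simp [Finset.sum_add_distrib]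
      _ ≤ A.card * B.card := by simpa using Finset.sum_le_card_nsmul A _ _ h1
  refine isGraphical_of_cut m d hsum ?_ ?_
  · intro v
    have hpos : 0 < Fintype.card V := Fintype.card_pos_iff.2 ⟨v⟩
    by_cases h : (Fintype.card V : ℝ) ≤ t
    · have h0 := hdA Finset.univ (by simpa using h)
      have h1 : d v ≤ ∑ v, d v := Finset.single_le_sum (fun _ _ => Nat.zero_le _) (Finset.mem_univ v)
      omega
    · have := (hd v).trans (not_le.1 h).le
      exact_mod_cast this
  · intro A B
    have hA1 : ∑ v ∈ A, m v ≤ ∑ v, m v :=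
      Finset.sum_le_sum_of_subset (Finset.subset_univ A)
    have hB1 : ∑ v ∈ B, d v ≤ ∑ v, d v :=
      Finset.sum_le_sum_of_subset (Finset.subset_univ B)
    have hA2 : (A ∩ B).card ≤ A.card := Finset.card_le_card Finset.inter_subset_left
    have hB2 : (A ∩ B).card ≤ B.card := Finset.card_le_card Finset.inter_subset_right
    -- Two small sets: each sum is at most half of the total, and the intersection is absorbed by
    -- the product of cardinalities. Exactly one large set: the product absorbs the other set's
    -- degree sum and the intersection. Two large sets: the product exceeds `t ^ 2`; half of the
    -- left side is the edge total, which with the number of nodes stays below `t ^ 2`.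
    rcases le_or_gt (A.card : ℝ) t with hA | hA <;> rcases le_or_gt (B.card : ℝ) t with hB | hB
    · have h1 := hmA A hA
      have h2 := hdA B hB
      have h3 : (A ∩ B).card ≤ A.card * B.card := by
        rcases Nat.eq_zero_or_pos A.card with h | h
        · omega
        · exact hB2.trans (Nat.le_mul_of_pos_left _ h)
      omega
    · have := hbound m A B hm hB
      omega
    · have := hbound d B A hd hA
      rw [mul_comm] at this
      omega
    · have h1 : t ^ 2 ≤ (A.card : ℝ) * B.card := by
        rw [sq]; exact mul_le_mul hA.le hB.le ht (Nat.cast_nonneg _)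
      have h2 : ∑ v, m v + Fintype.card V ≤ A.card * B.card := by
        have := hS.trans h1
        exact_mod_cast this
      have h3 := Finset.card_le_univ A
      omega

/-! ### Tail decay and moments -/

theorem tailProb_nonneg (F : PMF ℕ) (x : ℝ) : 0 ≤ tailProb F x := measureReal_nonneg

theorem tailProb_antitone (F : PMF ℕ) : Antitone (tailProb F) := fun _ _ hxy =>
  measureReal_mono fun _ hk => lt_of_le_of_lt hxy hk

/-- A power law majorant of index `α` with a slowly varying factor gives polynomial decay of the
tail with every exponent `q < α`. Only the values along a geometric progression are used. -/
theorem tailProb_le_rpow {F : PMF ℕ} {α q : ℝ} {L : ℝ → ℝ} (hL : IsSlowlyVarying L)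
    (hF : HasPowerLawMajorant F α L) (hq0 : 0 < q) (hq : q < α) :
    ∃ C X : ℝ, 0 < X ∧ 0 ≤ C ∧ ∀ x, X ≤ x → tailProb F x ≤ C * x ^ (-q) := by
  set U : ℝ → ℝ := fun x => x ^ (-α) * L x with hU
  have hr : (1 : ℝ) < 2 ^ (α - q) := Real.one_lt_rpow (by norm_num) (by linarith)
  obtain ⟨X, hX⟩ := eventually_atTop.1 ((((hL 2 two_pos).eventually_lt_const hr).and
    ((hL 2 two_pos).eventually_const_lt zero_lt_one)).and (eventually_gt_atTop 0))
  have hX0 : 0 < X := (hX X le_rfl).2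
  have hLpos : ∀ x, X ≤ x → 0 < L x := by
    intro x hx
    have hx0 : 0 < x := hX0.trans_le hx
    have h1 : 0 ≤ x ^ (-α) * L x := (tailProb_nonneg F x).trans (hF x hx0)
    have h2 : 0 ≤ L x := nonneg_of_mul_nonneg_right h1 (Real.rpow_pos_of_pos hx0 _)
    -- If `L x` vanished, the quotient at `x` would be 0 by the convention for division by zero,
    -- although it is positive there.
    refine lt_of_le_of_ne h2 fun h => ?_
    have := (hX x hx).1.2
    rw [← h] at this
    simp at this
  have hstep : ∀ x, X ≤ x → U (2 * x) ≤ 2 ^ (-q) * U x := by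
    intro x hx
    have hx0 : 0 < x := hX0.trans_le hx
    have h1 : L (2 * x) ≤ 2 ^ (α - q) * L x := ((div_lt_iff₀ (hLpos x hx)).1 (hX x hx).1.1).le
    calc U (2 * x) = 2 ^ (-α) * x ^ (-α) * L (2 * x) := by
          simp only [hU]; rw [Real.mul_rpow (by norm_num) hx0.le]
      _ ≤ 2 ^ (-α) * x ^ (-α) * (2 ^ (α - q) * L x) := by gcongr
      _ = 2 ^ (-q) * U x := by
          have : (2 : ℝ) ^ (-q) = 2 ^ (-α) * 2 ^ (α - q) := by
            rw [← Real.rpow_add (by norm_num)]; ring_nf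
          rw [this]; ring
  have hiter : ∀ j : ℕ, U (2 ^ j * X) ≤ (2 ^ j : ℝ) ^ (-q) * U X := by
    intro j
    induction j with
    | zero => simp
    | succ j ih =>
      have h1 : X ≤ 2 ^ j * X := le_mul_of_one_le_left hX0.le (one_le_pow₀ (by norm_num))
      calc U (2 ^ (j + 1) * X) = U (2 * (2 ^ j * X)) := by congr 1; ring
        _ ≤ 2 ^ (-q) * U (2 ^ j * X) := hstep _ h1
        _ ≤ 2 ^ (-q) * ((2 ^ j : ℝ) ^ (-q) * U X) := by gcongr
        _ = (2 ^ (j + 1) : ℝ) ^ (-q) * U X := by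
          rw [pow_succ', Real.mul_rpow (by norm_num) (by positivity)]; ring
  have hUX : 0 ≤ U X := (tailProb_nonneg F X).trans (hF X hX0)
  refine ⟨(2 * X) ^ q * U X, X, hX0, by positivity, fun x hx => ?_⟩
  have hx0 : 0 < x := hX0.trans_le hx
  -- Rounding `x` down to a dyadic multiple of `X` loses at most a factor 2, whence the constant `(2
  -- * X) ^ q`.
  obtain ⟨j, hj1, hj2⟩ := exists_nat_pow_near ((one_le_div hX0).2 hx) (one_lt_two (α := ℝ))
  rw [le_div_iff₀ hX0] at hj1
  rw [div_lt_iff₀ hX0] at hj2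
  have h2j : x / (2 * X) ≤ 2 ^ j := by
    rw [div_le_iff₀ (by positivity)]
    calc x ≤ 2 ^ (j + 1) * X := hj2.le
      _ = 2 ^ j * (2 * X) := by ring
  calc tailProb F x ≤ tailProb F (2 ^ j * X) := tailProb_antitone F hj1
    _ ≤ U (2 ^ j * X) := hF _ (by positivity)
    _ ≤ (2 ^ j : ℝ) ^ (-q) * U X := hiter j
    _ ≤ (x / (2 * X)) ^ (-q) * U X := by
        refine mul_le_mul_of_nonneg_right ?_ hUX
        exact Real.rpow_le_rpow_of_nonpos (by positivity) h2j (by linarith)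
    _ = (2 * X) ^ q * U X * x ^ (-q) := by
        rw [Real.div_rpow hx0.le (by positivity), Real.rpow_neg (by positivity : 0 ≤ 2 * X)]
        field_simp

/-- Polynomial decay of the tail gives finite moments of all smaller orders. -/
theorem integrable_rpow_of_tailProb_le {F : PMF ℕ} {p q C X : ℝ} (hp : 0 < p) (hpq : p < q)
    (hX : 0 < X) (hC : 0 ≤ C) (h : ∀ x, X ≤ x → tailProb F x ≤ C * x ^ (-q)) :
    Integrable (fun k : ℕ => (k : ℝ) ^ p) F.toMeasure := by
  refine ⟨(measurable_of_countable _).aestronglyMeasurable, ?_⟩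
  rw [hasFiniteIntegral_iff_ofReal (Eventually.of_forall fun k => by positivity),
    lintegral_rpow_eq_lintegral_meas_lt_mul F.toMeasure
      (Eventually.of_forall fun k : ℕ => Nat.cast_nonneg k)
      (measurable_of_countable _).aemeasurable hp]
  refine ENNReal.mul_lt_top ENNReal.ofReal_lt_top ?_
  -- Layer-cake integral split at `X`: below, the tail is at most 1 and `p > 0` gives integrability
  -- at 0; above, the decay of the tail and `p < q` give integrability at infinity.
  rw [← Set.Ioc_union_Ioi_eq_Ioi hX.le, lintegral_union measurableSet_Ioi
    (Set.Ioc_disjoint_Ioi le_rfl)]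
  refine ENNReal.add_lt_top.2 ⟨?_, ?_⟩
  · have hint : IntegrableOn (fun t : ℝ => t ^ (p - 1)) (Set.Ioc 0 X) := by
      rw [← intervalIntegrable_iff_integrableOn_Ioc_of_le hX.le]
      exact intervalIntegral.intervalIntegrable_rpow' (by linarith)
    refine lt_of_le_of_lt (setLIntegral_mono' measurableSet_Ioc fun t ht =>
      mul_le_of_le_one_left zero_le prob_le_one) ?_
    exact hint.lintegral_lt_top
  · have hint : IntegrableOn (fun t : ℝ => C * t ^ (p - 1 - q)) (Set.Ioi X) :=
      (integrableOn_Ioi_rpow_of_lt (by linarith) hX).const_mul C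
    refine lt_of_le_of_lt (setLIntegral_mono' measurableSet_Ioi fun t ht => ?_) 
      hint.lintegral_lt_top
    have ht0 : 0 < t := hX.trans ht
    have h1 : F.toMeasure {k : ℕ | t < (k : ℝ)} ≤ ENNReal.ofReal (C * t ^ (-q)) := by
      rw [← ofReal_measureReal]
      exact ENNReal.ofReal_le_ofReal (h t (le_of_lt ht))
    calc _ ≤ ENNReal.ofReal (C * t ^ (-q)) * ENNReal.ofReal (t ^ (p - 1)) := by gcongr
      _ = ENNReal.ofReal (C * t ^ (p - 1 - q)) := by
        rw [← ENNReal.ofReal_mul (by positivity), mul_assoc, ← Real.rpow_add ht0]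
        ring_nf

theorem integrable_rpow_of_hasPowerLawMajorant {F : PMF ℕ} {α p : ℝ} {L : ℝ → ℝ} (hL : IsSlowlyVarying L)
    (hF : HasPowerLawMajorant F α L) (hp : 0 < p) (hpα : p < α) :
    Integrable (fun k : ℕ => (k : ℝ) ^ p) F.toMeasure := by
  obtain ⟨q, hpq, hqα⟩ := exists_between hpα
  obtain ⟨C, X, hX, hC, h⟩ := tailProb_le_rpow hL hF (hp.trans hpq) hqα
  exact integrable_rpow_of_tailProb_le hp hpq hX hC h

theorem HasMean.integral_eq {F : PMF ℕ} {μ : ℝ} (h : HasMean F μ)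
    (hint : Integrable (fun k : ℕ => (k : ℝ)) F.toMeasure) :
    ∫ k, (k : ℝ) ∂F.toMeasure = μ := by
  rw [PMF.integral_eq_tsum _ _ hint, ← h.tsum_eq]
  exact tsum_congr fun k => by rw [smul_eq_mul, mul_comm]

/-! ### Concentration of i.i.d. sums -/

theorem pi_markov (F : PMF ℕ) (n : ℕ) {f : ℕ → ℝ} (hf0 : ∀ k, 0 ≤ f k)
    (hf : Integrable f F.toMeasure) {t : ℝ} (ht : 0 < t) :
    (Measure.pi fun _ : Fin n => F.toMeasure).real {γ | t ≤ ∑ i, f (γ i)} ≤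
      n * (∫ k, f k ∂F.toMeasure) / t := by
  have hi : ∀ i : Fin n, Integrable (fun γ : Fin n → ℕ => f (γ i))
      (Measure.pi fun _ : Fin n => F.toMeasure) := fun i => integrable_comp_eval hf
  have h := mul_meas_ge_le_integral_of_nonneg
    (μ := Measure.pi fun _ : Fin n => F.toMeasure) (f := fun γ => ∑ i, f (γ i))
    (Eventually.of_forall fun γ => Finset.sum_nonneg fun i _ => hf0 _)
    (integrable_finsetSum _ fun i _ => hi i) t
  rw [integral_finsetSum _ fun i _ => hi i] at h
  have h2 : ∀ i : Fin n, ∫ γ : Fin n → ℕ, f (γ i) ∂(Measure.pi fun _ : Fin n => F.toMeasure) =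
      ∫ k, f k ∂F.toMeasure := fun i =>
    integral_comp_eval (μ := fun _ : Fin n => F.toMeasure) (i := i) hf.aestronglyMeasurable
  simp only [h2, Finset.sum_const, Finset.card_univ, Fintype.card_fin, nsmul_eq_mul] at h
  rw [le_div_iff₀ ht, mul_comm]
  exact h

/-- Meant for truncated variables: boundedness supplies square integrability even if `F` has
infinite variance, and the variance is replaced by the second moment, which truncation controls. -/
theorem pi_chebyshev (F : PMF ℕ) (n : ℕ) {f : ℕ → ℝ} {B : ℝ} (hB : ∀ k, |f k| ≤ B)
    {t : ℝ} (ht : 0 < t) :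
    (Measure.pi fun _ : Fin n => F.toMeasure).real
        {γ | t ≤ |∑ i, f (γ i) - n * ∫ k, f k ∂F.toMeasure|} ≤
      n * (∫ k, f k ^ 2 ∂F.toMeasure) / t ^ 2 := by
  have hLp : MemLp f 2 F.toMeasure :=
    MemLp.of_bound (measurable_of_countable _).aestronglyMeasurable B
      (Eventually.of_forall fun k => by simpa using hB k)
  have hLpi : ∀ i : Fin n, MemLp (fun γ : Fin n → ℕ => f (γ i)) 2
      (Measure.pi fun _ : Fin n => F.toMeasure) := fun i =>
    hLp.comp_measurePreserving (measurePreserving_eval (fun _ : Fin n => F.toMeasure) i)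
  have hsum : MemLp (∑ i : Fin n, fun γ : Fin n → ℕ => f (γ i)) 2
      (Measure.pi fun _ : Fin n => F.toMeasure) := memLp_finsetSum' _ fun i _ => hLpi i
  have h := ProbabilityTheory.meas_ge_le_variance_div_sq hsum ht
  have hvar := ProbabilityTheory.variance_sum_pi (μ := fun _ : Fin n => F.toMeasure)
    (X := fun _ => f) fun _ => hLp
  have hv1 := ProbabilityTheory.variance_le_expectation_sq (μ := F.toMeasure)
    hLp.aestronglyMeasurable
  have hmean : ∫ γ, (∑ i : Fin n, fun γ : Fin n → ℕ => f (γ i)) γ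
      ∂(Measure.pi fun _ : Fin n => F.toMeasure) = n * ∫ k, f k ∂F.toMeasure := by
    simp only [Finset.sum_apply]
    rw [integral_finsetSum _ fun i _ => (hLpi i).integrable (by norm_num)]
    have h2 : ∀ i : Fin n, ∫ γ : Fin n → ℕ, f (γ i) ∂(Measure.pi fun _ : Fin n => F.toMeasure) =
        ∫ k, f k ∂F.toMeasure := fun i =>
      integral_comp_eval (μ := fun _ : Fin n => F.toMeasure) (i := i) hLp.aestronglyMeasurable
    simp [h2]
  rw [hvar, hmean] at h
  simp only [Finset.sum_apply, Finset.sum_const, Finset.card_univ, Fintype.card_fin,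
    nsmul_eq_mul] at h
  refine (ENNReal.toReal_mono ENNReal.ofReal_ne_top h).trans ?_
  rw [ENNReal.toReal_ofReal (by positivity [ProbabilityTheory.variance_nonneg f F.toMeasure])]
  gcongr
  exact hv1

/-- A sequence of `n` numbers that is typical for i.i.d. samples with mean `μ`: the sum deviates
from `n μ` by at most `n ^ a / 2`, no term exceeds `n ^ a`, and terms above `n ^ c` contribute
little to the sum. -/
def typicalSet (μ a c : ℝ) (n : ℕ) : Set (Fin n → ℕ) :=
  {γ | |∑ i, (γ i : ℝ) - n * μ| ≤ (n : ℝ) ^ a / 2 ∧ (∀ i, (γ i : ℝ) ≤ (n : ℝ) ^ a) ∧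
    ∑ i, (if (n : ℝ) ^ c < γ i then (γ i : ℝ) else 0) ≤ n * μ / 8}

/-- Since 1 - p is negative, k = k ^ p * k ^ (1 - p) is at most k ^ p * x ^ (1 - p) above `x`. The
next lemma factors k ^ 2 in the same way below `x`. -/
theorem integral_large_le {F : PMF ℕ} {p x : ℝ} (hp : 1 < p) (hx : 0 < x)
    (hint : Integrable (fun k : ℕ => (k : ℝ) ^ p) F.toMeasure) :
    Integrable (fun k : ℕ => if x < k then (k : ℝ) else 0) F.toMeasure ∧
    ∫ k : ℕ, (if x < k then (k : ℝ) else 0) ∂F.toMeasure ≤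
      (∫ k : ℕ, (k : ℝ) ^ p ∂F.toMeasure) * x ^ (1 - p) := by
  have hle : ∀ k : ℕ, (if x < k then (k : ℝ) else 0) ≤ (k : ℝ) ^ p * x ^ (1 - p) := by
    intro k
    split_ifs with h
    · have hk : (0 : ℝ) < k := hx.trans h
      calc (k : ℝ) = (k : ℝ) ^ p * (k : ℝ) ^ (1 - p) := by
            rw [← Real.rpow_add hk]; simp
        _ ≤ (k : ℝ) ^ p * x ^ (1 - p) :=
            mul_le_mul_of_nonneg_left (Real.rpow_le_rpow_of_nonpos hx h.le (by linarith))
              (by positivity)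
    · positivity
  have h0 : ∀ k : ℕ, 0 ≤ (if x < k then (k : ℝ) else 0) := fun k => by positivity
  have hi := (hint.mul_const (x ^ (1 - p))).mono'
    (measurable_of_countable (fun k : ℕ => if x < k then (k : ℝ) else 0)).aestronglyMeasurable
    (Eventually.of_forall fun k => by rw [Real.norm_of_nonneg (h0 k)]; exact hle k)
  refine ⟨hi, ?_⟩
  rw [← integral_mul_const]
  exact integral_mono hi (hint.mul_const _) hle

theorem integral_small_sq_le {F : PMF ℕ} {p x : ℝ} (hp2 : p ≤ 2) (hx : 0 < x)
    (hint : Integrable (fun k : ℕ => (k : ℝ) ^ p) F.toMeasure) :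
    ∫ k : ℕ, (if (k : ℝ) ≤ x then (k : ℝ) else 0) ^ 2 ∂F.toMeasure ≤
      (∫ k : ℕ, (k : ℝ) ^ p ∂F.toMeasure) * x ^ (2 - p) := by
  have hle : ∀ k : ℕ, (if (k : ℝ) ≤ x then (k : ℝ) else 0) ^ 2 ≤ (k : ℝ) ^ p * x ^ (2 - p) := by
    intro k
    split_ifs with h
    · rcases Nat.eq_zero_or_pos k with rfl | hk
      · simp; positivity
      have hk : (0 : ℝ) < k := by exact_mod_cast hk
      calc (k : ℝ) ^ 2 = (k : ℝ) ^ p * (k : ℝ) ^ (2 - p) := by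
            rw [← Real.rpow_add hk]; simp
        _ ≤ (k : ℝ) ^ p * x ^ (2 - p) :=
            mul_le_mul_of_nonneg_left (Real.rpow_le_rpow hk.le h (by linarith)) (by positivity)
    · simp; positivity
  rw [← integral_mul_const]
  exact integral_mono_of_nonneg (Eventually.of_forall fun k => by positivity)
    (hint.mul_const _) (Eventually.of_forall hle)

/-- Quantitative bound for the probability that i.i.d. samples are not typical. -/
theorem pi_typicalSet_compl_le {F : PMF ℕ} {μ a c p : ℝ} {n : ℕ} (hn : 0 < n) (hμ : 0 < μ)
    (hmean : HasMean F μ) (hp : 1 < p) (hp2 : p ≤ 2)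
    (hint : Integrable (fun k : ℕ => (k : ℝ) ^ p) F.toMeasure)
    (hsmall : (∫ k : ℕ, (k : ℝ) ^ p ∂F.toMeasure) * (n : ℝ) ^ (1 - a * p) ≤ 1 / 4) :
    (Measure.pi fun _ : Fin n => F.toMeasure).real (typicalSet μ a c n)ᶜ ≤
      (∫ k : ℕ, (k : ℝ) ^ p ∂F.toMeasure) *
        (17 * (n : ℝ) ^ (1 - a * p) + 8 / μ * (n : ℝ) ^ (c * (1 - p))) := by
  set M := ∫ k : ℕ, (k : ℝ) ^ p ∂F.toMeasure with hM
  have hn0 : (0 : ℝ) < n := by exact_mod_cast hn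
  set x := (n : ℝ) ^ a with hx
  set K := (n : ℝ) ^ c with hK
  have hx0 : 0 < x := Real.rpow_pos_of_pos hn0 _
  have hK0 : 0 < K := Real.rpow_pos_of_pos hn0 _
  have hM0 : 0 ≤ M := integral_nonneg fun k => by positivity
  obtain ⟨hi1, hb1⟩ := integral_large_le hp hx0 hint
  obtain ⟨hi2, hb2⟩ := integral_large_le hp hK0 hint
  have hb3 := integral_small_sq_le hp2 hx0 hint
  have hbd : ∀ k : ℕ, |(if (k : ℝ) ≤ x then (k : ℝ) else 0)| ≤ x := by
    intro k
    split_ifs with h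
    · rwa [abs_of_nonneg (Nat.cast_nonneg k)]
    · simpa using hx0.le
  have hi4 : Integrable (fun k : ℕ => if (k : ℝ) ≤ x then (k : ℝ) else 0) F.toMeasure :=
    Integrable.of_bound (measurable_of_countable _).aestronglyMeasurable x
      (Eventually.of_forall hbd)
  have hsplit : ∀ k : ℕ, (k : ℝ) =
      (if (k : ℝ) ≤ x then (k : ℝ) else 0) + (if x < k then (k : ℝ) else 0) := by
    intro k
    rcases le_or_gt (k : ℝ) x with h | h
    · simp [h, not_lt.2 h]
    · simp [h, not_le.2 h]
  have hik : Integrable (fun k : ℕ => (k : ℝ)) F.toMeasure :=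
    (hi4.add hi1).congr (Eventually.of_forall fun k => (hsplit k).symm)
  have hμeq : μ = ∫ k : ℕ, (if (k : ℝ) ≤ x then (k : ℝ) else 0) ∂F.toMeasure +
      ∫ k : ℕ, (if x < k then (k : ℝ) else 0) ∂F.toMeasure := by
    rw [← integral_add hi4 hi1, ← hmean.integral_eq hik]
    exact integral_congr_ae (Eventually.of_forall hsplit)
  set m := ∫ k : ℕ, (if (k : ℝ) ≤ x then (k : ℝ) else 0) ∂F.toMeasure with hm
  set r := ∫ k : ℕ, (if x < k then (k : ℝ) else 0) ∂F.toMeasure with hr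
  have hr0 : 0 ≤ r := integral_nonneg fun k => by positivity
  have hxp : ∀ s : ℝ, x ^ s = (n : ℝ) ^ (a * s) := fun s => by
    rw [hx, ← Real.rpow_mul hn0.le]
  -- The bias caused by truncation uses up half of the allowed deviation `x / 2`.
  have hnr : n * r ≤ x / 4 := by
    calc n * r ≤ n * (M * x ^ (1 - p)) := by gcongr
      _ = x * (M * (n : ℝ) ^ (1 - a * p)) := by
        rw [hxp, hx, show a * (1 - p) = (1 - a * p) + a - 1 by ring, Real.rpow_sub hn0,
          Real.rpow_add hn0, Real.rpow_one]
        field_simp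
      _ ≤ x * (1 / 4) := by gcongr
      _ = x / 4 := by ring
  -- A single term above `x` already makes the sum of `p`-th powers reach `x ^ p`. Outside that
  -- event the truncated sum is the true sum, so a fluctuation below `x / 4` together with the bias
  -- stays within `x / 2`.
  have hsub : (typicalSet μ a c n)ᶜ ⊆
      ({γ | x ^ p ≤ ∑ i, (γ i : ℝ) ^ p} ∪
        {γ | n * μ / 8 ≤ ∑ i, (if K < γ i then (γ i : ℝ) else 0)}) ∪
        {γ | x / 4 ≤ |∑ i, (if (γ i : ℝ) ≤ x then (γ i : ℝ) else 0) - n * m|} := by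
    intro γ hγ
    by_contra hcon
    simp only [Set.mem_union, Set.mem_ofPred_eq, not_or, not_le] at hcon
    obtain ⟨⟨h1, h2⟩, h3⟩ := hcon
    have hmax : ∀ i, (γ i : ℝ) ≤ x := by
      intro i
      by_contra h
      have h4 : x ^ p ≤ (γ i : ℝ) ^ p :=
        Real.rpow_le_rpow hx0.le (not_le.1 h).le (by linarith)
      have h5 : (γ i : ℝ) ^ p ≤ ∑ i, (γ i : ℝ) ^ p :=
        Finset.single_le_sum (f := fun i => (γ i : ℝ) ^ p) (fun j _ => by positivity)
          (Finset.mem_univ i)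
      linarith
    refine hγ ⟨?_, hmax, h2.le⟩
    simp only [hmax, if_true] at h3
    have h4 : ∑ i, (γ i : ℝ) - n * μ = (∑ i, (γ i : ℝ) - n * m) - n * r := by rw [hμeq]; ring
    rw [h4]
    have h5 : |(n : ℝ) * r| ≤ x / 4 := by rwa [abs_of_nonneg (by positivity)]
    calc _ ≤ |∑ i, (γ i : ℝ) - n * m| + |n * r| := abs_sub _ _
      _ ≤ x / 4 + x / 4 := add_le_add h3.le h5
      _ = x / 2 := by ring
  have hp1 := pi_markov F n (f := fun k => (k : ℝ) ^ p) (fun k => by positivity) hint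
    (t := x ^ p) (by positivity)
  have hp2' := pi_markov F n (f := fun k : ℕ => if K < k then (k : ℝ) else 0)
    (fun k => by positivity) hi2 (t := n * μ / 8) (by positivity)
  have hp3 := pi_chebyshev F n hbd (t := x / 4) (by positivity)
  refine (measureReal_mono hsub).trans ((measureReal_union_le _ _).trans
    ((add_le_add_left (measureReal_union_le _ _) _).trans ?_))
  refine (add_le_add (add_le_add hp1 hp2') hp3).trans ?_
  -- The constant 17 is 1 from this event plus 16 from the `x / 4` in Chebyshev's inequality.
  have e1 : (n : ℝ) * M / x ^ p = M * (n : ℝ) ^ (1 - a * p) := by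
    rw [hxp, Real.rpow_sub hn0, Real.rpow_one]; ring
  have e2 : (n : ℝ) * (∫ k : ℕ, (if K < k then (k : ℝ) else 0) ∂F.toMeasure) / (n * μ / 8) ≤
      M * (8 / μ * (n : ℝ) ^ (c * (1 - p))) := by
    rw [div_le_iff₀ (by positivity)]
    calc _ ≤ n * (M * K ^ (1 - p)) := by gcongr
      _ = _ := by rw [hK, ← Real.rpow_mul hn0.le]; field_simp
  have e3 : (n : ℝ) * (∫ k : ℕ, (if (k : ℝ) ≤ x then (k : ℝ) else 0) ^ 2 ∂F.toMeasure) /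
      (x / 4) ^ 2 ≤ M * (16 * (n : ℝ) ^ (1 - a * p)) := by
    rw [div_le_iff₀ (by positivity)]
    calc _ ≤ n * (M * x ^ (2 - p)) := by gcongr
      _ = _ := by
        rw [hxp, hx, show a * (2 - p) = (1 - a * p) + a + a - 1 by ring, Real.rpow_sub hn0,
          Real.rpow_add hn0, Real.rpow_add hn0, Real.rpow_one]
        field_simp
        ring
  linarith

theorem tendsto_pi_typicalSet {F : PMF ℕ} {μ a c α : ℝ} {L : ℝ → ℝ} (hμ : 0 < μ)
    (hmean : HasMean F μ) (hL : IsSlowlyVarying L) (hF : HasPowerLawMajorant F α L)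
    (ha : 1 / 2 < a) (ha1 : a < 1) (hα : 0 < α) (haα : α⁻¹ < a) (hc : 0 < c) :
    Tendsto (fun n => (Measure.pi fun _ : Fin n => F.toMeasure) (typicalSet μ a c n))
      atTop (𝓝 1) := by
  have ha0 : 0 < a := by linarith
  -- Room for `p`: below `α` for a finite moment, at most 2 for the truncated second moment, above
  -- 1/a so that `n ^ (1 - a * p)` tends to 0. As `a < 1`, also `p > 1`, which makes the
  -- contribution of large terms vanish.
  have h1 : a⁻¹ < min α 2 := by
    refine lt_min (inv_lt_of_inv_lt₀ hα haα) ?_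
    exact inv_lt_of_inv_lt₀ two_pos (by simpa using ha)
  obtain ⟨p, hp1, hp2⟩ := exists_between h1
  have hp : 1 < p := (one_lt_inv₀ ha0).2 ha1 |>.trans hp1
  have hap : 0 < a * p - 1 := by
    have := mul_lt_mul_of_pos_left hp1 ha0
    rw [mul_inv_cancel₀ ha0.ne'] at this
    linarith
  have hint := integrable_rpow_of_hasPowerLawMajorant hL hF (zero_lt_one.trans hp)
    (hp2.trans_le (min_le_left _ _))
  set M := ∫ k : ℕ, (k : ℝ) ^ p ∂F.toMeasure with hM
  have t1 : Tendsto (fun n : ℕ => (n : ℝ) ^ (1 - a * p)) atTop (𝓝 0) := by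
    have := (tendsto_rpow_neg_atTop hap).comp tendsto_natCast_atTop_atTop
    simpa [Function.comp_def] using this
  have t2 : Tendsto (fun n : ℕ => (n : ℝ) ^ (c * (1 - p))) atTop (𝓝 0) := by
    have := (tendsto_rpow_neg_atTop (show 0 < c * (p - 1) by nlinarith)).comp
      tendsto_natCast_atTop_atTop
    refine this.congr fun n => ?_
    simp only [Function.comp_def]
    ring_nf
  have t3 : Tendsto (fun n : ℕ => M * (17 * (n : ℝ) ^ (1 - a * p) +
      8 / μ * (n : ℝ) ^ (c * (1 - p)))) atTop (𝓝 0) := by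
    simpa using ((t1.const_mul 17).add (t2.const_mul (8 / μ))).const_mul M
  have t4 : Tendsto (fun n : ℕ => M * (n : ℝ) ^ (1 - a * p)) atTop (𝓝 0) := by
    simpa using t1.const_mul M
  have t5 : Tendsto (fun n => (Measure.pi fun _ : Fin n => F.toMeasure).real
      (typicalSet μ a c n)ᶜ) atTop (𝓝 0) := by
    refine squeeze_zero' (Eventually.of_forall fun n => measureReal_nonneg) ?_ t3
    filter_upwards [eventually_gt_atTop 0, t4.eventually_le_const (show (0 : ℝ) < 1 / 4 by norm_num)]
      with n hn hs
    exact pi_typicalSet_compl_le hn hμ hmean hp (hp2.le.trans (min_le_right _ _)) hint hs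
  have t6 : Tendsto (fun n => (Measure.pi fun _ : Fin n => F.toMeasure).real
      (typicalSet μ a c n)) atTop (𝓝 1) := by
    have := t5.const_sub 1
    rw [sub_zero] at this
    refine this.congr fun n => ?_
    rw [probReal_compl_eq_one_sub (DiscreteMeasurableSpace.forall_measurableSet _)]
    ring
  have := ENNReal.tendsto_ofReal t6
  simpa using this

/-! ### From typical samples to graphical sequences -/

theorem card_chosen {n k : ℕ} (σ : Equiv.Perm (Fin n)) (hk : k ≤ n) :
    (DegreeAlgorithm.chosen σ k).card = k := by
  have h : DegreeAlgorithm.chosen σ k =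
      (Finset.univ.filter fun j : Fin n => (j : ℕ) < k).map σ.toEmbedding := by
    ext i
    simp [DegreeAlgorithm.chosen, Finset.mem_map_equiv]
  rw [h, Finset.card_map, Fin.card_filter_val_lt, min_eq_right hk]

/-- The smaller sum gains one unit per chosen node; the bound by `n` guarantees that |Δ| distinct
nodes are available. -/
theorem sum_correct_eq {n : ℕ} (s : DegreeAlgorithm.Sample n) (σ : Equiv.Perm (Fin n))
    (h : (DegreeAlgorithm.excess s).natAbs ≤ n) :
    ∑ i, (DegreeAlgorithm.correct s σ).1 i = ∑ i, (DegreeAlgorithm.correct s σ).2 i := by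
  have hc := card_chosen σ h
  have he : DegreeAlgorithm.excess s = ((∑ i, s.1 i : ℕ) : ℤ) - ((∑ i, s.2 i : ℕ) : ℤ) := by
    simp [DegreeAlgorithm.excess]
  simp only [DegreeAlgorithm.correct, Finset.sum_add_distrib]
  rcases lt_or_ge (DegreeAlgorithm.excess s) 0 with h0 | h0
  · simp only [h0, not_le.2 h0, true_and, false_and, if_false, Finset.sum_const_zero,
      Finset.sum_ite_mem, Finset.univ_inter, Finset.sum_const, hc, smul_eq_mul]
    omega
  · simp only [h0, not_lt.2 h0, true_and, false_and, if_false, Finset.sum_const_zero,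
      Finset.sum_ite_mem, Finset.univ_inter, Finset.sum_const, hc, smul_eq_mul]
    omega

/-- The conditions on `n`, satisfied for all large `n`, under which typical samples give graphical
sequences. -/
structure LargeEnough (μ a b c : ℝ) (n : ℕ) : Prop where
  max_le : (n : ℝ) ^ a + 2 ≤ (n : ℝ) ^ b
  small_sets : (n : ℝ) ^ b * ((n : ℝ) ^ c + 1) ≤ n * μ / 8
  fluctuation : (n : ℝ) ^ a ≤ n * μ
  rpow_le : (n : ℝ) ^ a ≤ n
  edges : n * (μ + 3) ≤ ((n : ℝ) ^ b) ^ 2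

/-- On `A`, terms up to `n ^ c` and the corrections contribute at most `n * μ / 8`, and so do the
larger terms, while the whole sum is at least `n * μ / 2`. -/
theorem two_mul_sum_le_of_typical {μ a b c : ℝ} {n : ℕ} (hn : LargeEnough μ a b c n)
    {γ e : Fin n → ℕ} (hγ : γ ∈ typicalSet μ a c n) (he : ∀ i, γ i ≤ e i)
    (he1 : ∀ i, e i ≤ γ i + 1) (A : Finset (Fin n)) (hA : (A.card : ℝ) ≤ (n : ℝ) ^ b) :
    2 * ∑ i ∈ A, e i ≤ ∑ i, e i := by
  obtain ⟨h1, -, h3⟩ := hγ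
  have hK0 : 0 ≤ (n : ℝ) ^ c := by positivity
  have hterm : ∀ i, (e i : ℝ) ≤ ((n : ℝ) ^ c + 1) +
      (if (n : ℝ) ^ c < γ i then (γ i : ℝ) else 0) := by
    intro i
    have h : (e i : ℝ) ≤ γ i + 1 := by exact_mod_cast he1 i
    split_ifs with hi
    · linarith
    · linarith [not_lt.1 hi]
  have hsumA : (∑ i ∈ A, (e i : ℝ)) ≤ n * μ / 4 := by
    calc (∑ i ∈ A, (e i : ℝ)) ≤ ∑ i ∈ A, (((n : ℝ) ^ c + 1) +
          (if (n : ℝ) ^ c < γ i then (γ i : ℝ) else 0)) := Finset.sum_le_sum fun i _ => hterm i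
      _ = A.card * ((n : ℝ) ^ c + 1) +
          ∑ i ∈ A, (if (n : ℝ) ^ c < γ i then (γ i : ℝ) else 0) := by
        rw [Finset.sum_add_distrib, Finset.sum_const, nsmul_eq_mul]
      _ ≤ (n : ℝ) ^ b * ((n : ℝ) ^ c + 1) +
          ∑ i, (if (n : ℝ) ^ c < γ i then (γ i : ℝ) else 0) := by
        refine add_le_add (by gcongr) ?_
        exact Finset.sum_le_sum_of_subset_of_nonneg (Finset.subset_univ A)
          fun i _ _ => by positivity
      _ ≤ n * μ / 4 := by linarith [hn.small_sets]
  have hsum : n * μ / 2 ≤ ∑ i, (e i : ℝ) := by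
    have h4 : ∑ i, (γ i : ℝ) ≤ ∑ i, (e i : ℝ) :=
      Finset.sum_le_sum fun i _ => by exact_mod_cast he i
    linarith [(abs_le.1 h1).1, hn.fluctuation]
  have : 2 * ∑ i ∈ A, (e i : ℝ) ≤ ∑ i, (e i : ℝ) := by linarith
  exact_mod_cast this

/-- The excess is a difference of two deviations of size at most half the acceptance bound.
Graphicality follows from the threshold criterion at `n ^ b`, whatever the permutation. -/
theorem accepted_and_isGraphical_of_typical {μ κ δ₀ b c : ℝ} {n : ℕ}
    (hn : LargeEnough μ (1 - κ + δ₀) b c n) {s : DegreeAlgorithm.Sample n}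
    (h1 : s.1 ∈ typicalSet μ (1 - κ + δ₀) c n) (h2 : s.2 ∈ typicalSet μ (1 - κ + δ₀) c n)
    (σ : Equiv.Perm (Fin n)) :
    DegreeAlgorithm.Accepted κ δ₀ s ∧
      IsGraphical (DegreeAlgorithm.correct s σ).1 (DegreeAlgorithm.correct s σ).2 := by
  have hacc : DegreeAlgorithm.Accepted κ δ₀ s := by
    have he : (DegreeAlgorithm.excess s : ℝ) =
        (∑ i, (s.1 i : ℝ) - n * μ) - (∑ i, (s.2 i : ℝ) - n * μ) := by
      simp [DegreeAlgorithm.excess]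
    rw [DegreeAlgorithm.Accepted, he]
    calc _ ≤ |∑ i, (s.1 i : ℝ) - n * μ| + |∑ i, (s.2 i : ℝ) - n * μ| := abs_sub _ _
      _ ≤ _ := by linarith [h1.1, h2.1]
  refine ⟨hacc, ?_⟩
  have hle : (DegreeAlgorithm.excess s).natAbs ≤ n := by
    have h := hacc.trans hn.rpow_le
    rw [← Int.cast_abs, Int.abs_eq_natAbs] at h
    exact_mod_cast h
  have hm1 : ∀ i, s.1 i ≤ (DegreeAlgorithm.correct s σ).1 i := fun i => Nat.le_add_right _ _
  have hd1 : ∀ i, s.2 i ≤ (DegreeAlgorithm.correct s σ).2 i := fun i => Nat.le_add_right _ _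
  have hm2 : ∀ i, (DegreeAlgorithm.correct s σ).1 i ≤ s.1 i + 1 := fun i =>
    Nat.add_le_add_left (by split_ifs <;> simp) _
  have hd2 : ∀ i, (DegreeAlgorithm.correct s σ).2 i ≤ s.2 i + 1 := fun i =>
    Nat.add_le_add_left (by split_ifs <;> simp) _
  refine isGraphical_of_threshold _ _ ((n : ℝ) ^ b) (sum_correct_eq s σ hle) (by positivity)
    (fun i => ?_) (fun i => ?_) (two_mul_sum_le_of_typical hn h1 hm1 hm2)
    (two_mul_sum_le_of_typical hn h2 hd1 hd2) ?_
  -- The 2 in `max_le` covers the correction and the 1 in the threshold hypothesis.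
  · have h : ((DegreeAlgorithm.correct s σ).1 i : ℝ) ≤ s.1 i + 1 := by exact_mod_cast hm2 i
    linarith [hn.max_le, h1.2.1 i]
  · have h : ((DegreeAlgorithm.correct s σ).2 i : ℝ) ≤ s.2 i + 1 := by exact_mod_cast hd2 i
    linarith [hn.max_le, h2.2.1 i]
  -- Edges beyond `n * μ`: at most `n ^ a / 2` from fluctuation and `n` from corrections. A further
  -- `n` is the number of nodes, so `n * (μ + 3)` suffices.
  · have h : ((∑ i, (DegreeAlgorithm.correct s σ).1 i : ℕ) : ℝ) ≤ ∑ i, ((s.1 i : ℝ) + 1) := by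
      push_cast
      exact Finset.sum_le_sum fun i _ => by exact_mod_cast hm2 i
    rw [Finset.sum_add_distrib] at h
    simp only [Finset.sum_const, Finset.card_univ, Fintype.card_fin, nsmul_eq_mul, mul_one] at h
    rw [Fintype.card_fin]
    have := (abs_le.1 h1.1).2
    have h0 : 0 ≤ (n : ℝ) := Nat.cast_nonneg n
    linarith [hn.edges, hn.rpow_le]

/-! ### Choice of exponents and the limit -/

theorem eventually_const_mul_rpow_le (C : ℝ) {s t : ℝ} (hst : s < t) :
    ∀ᶠ n : ℕ in atTop, C * (n : ℝ) ^ s ≤ (n : ℝ) ^ t := by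
  have h := ((tendsto_rpow_atTop (sub_pos.2 hst)).comp
    tendsto_natCast_atTop_atTop).eventually_ge_atTop C
  filter_upwards [h, eventually_gt_atTop 0] with n hn hn0
  have hn0' : (0 : ℝ) < n := by exact_mod_cast hn0
  calc C * (n : ℝ) ^ s ≤ (n : ℝ) ^ (t - s) * (n : ℝ) ^ s := by gcongr; exact hn
    _ = (n : ℝ) ^ t := by rw [← Real.rpow_add hn0']; ring_nf

theorem eventually_largeEnough {μ a b c : ℝ} (hμ : 0 < μ) (ha : 0 < a) (ha1 : a < 1)
    (hab : a < b) (hb : 1 / 2 < b) (hc : 0 < c) (hbc : b + c < 1) :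
    ∀ᶠ n : ℕ in atTop, LargeEnough μ a b c n := by
  -- As `n ^ a` and `n ^ c` are at least 1, the factor 3 absorbs the additive 2, and 16 = 2 * 8
  -- absorbs the additive 1 in `small_sets`.
  filter_upwards [eventually_const_mul_rpow_le 3 hab, eventually_const_mul_rpow_le (16 / μ) hbc,
    eventually_const_mul_rpow_le μ⁻¹ ha1, eventually_const_mul_rpow_le 1 ha1,
    eventually_const_mul_rpow_le (μ + 3) (show (1 : ℝ) < b * 2 by linarith),
    eventually_ge_atTop 1] with n h1 h2 h3 h4 h5 hn
  have hn1 : (1 : ℝ) ≤ n := by exact_mod_cast hn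
  have hn0 : (0 : ℝ) < n := by linarith
  rw [Real.rpow_one] at h2 h3 h4 h5
  have ha2 := Real.one_le_rpow hn1 ha.le
  have hc2 := Real.one_le_rpow hn1 hc.le
  refine ⟨by linarith, ?_, ?_, by linarith, ?_⟩
  · rw [Real.rpow_add hn0] at h2
    have hb0 : 0 ≤ (n : ℝ) ^ b := by positivity
    rw [div_mul_eq_mul_div, div_le_iff₀ hμ] at h2
    nlinarith [mul_le_mul_of_nonneg_left hc2 hb0]
  · rw [inv_mul_le_iff₀ hμ] at h3
    linarith
  · rw [Real.rpow_mul hn0.le, Real.rpow_two] at h5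
    linarith

/-- It suffices that the very first round is accepted and leads to a graphical sequence. -/
theorem sampleLaw_le_inputLaw_graphicalEvent (F G : PMF ℕ) {κ δ₀ : ℝ} {n : ℕ}
    {T : Set (DegreeAlgorithm.Sample n)}
    (h : ∀ s ∈ T, ∀ σ, DegreeAlgorithm.Accepted κ δ₀ s ∧
      IsGraphical (DegreeAlgorithm.correct s σ).1 (DegreeAlgorithm.correct s σ).2) :
    DegreeAlgorithm.sampleLaw F G n T ≤
      DegreeAlgorithm.inputLaw F G n (DegreeAlgorithm.graphicalEvent κ δ₀ n) := by
  have hmp : MeasurePreserving (fun ω : DegreeAlgorithm.Input n => ω.1 0)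
      (DegreeAlgorithm.inputLaw F G n) (DegreeAlgorithm.sampleLaw F G n) :=
    (measurePreserving_eval_infinitePi (fun _ : ℕ => DegreeAlgorithm.sampleLaw F G n) 0).comp
      measurePreserving_fst
  rw [← hmp.measure_preimage (DiscreteMeasurableSpace.forall_measurableSet T).nullMeasurableSet]
  -- Monotonicity alone is used, so the graphical event need not be shown measurable.
  refine measure_mono fun ω hω => ?_
  obtain ⟨hacc, hgr⟩ := h _ hω ω.2
  have hex : ∃ r, DegreeAlgorithm.Accepted κ δ₀ (ω.1 r) := ⟨0, hacc⟩
  have h0 : @Nat.find _ (fun _ => Classical.propDecidable _) hex = 0 :=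
    Nat.le_zero.1 (@Nat.find_min' _ (fun _ => Classical.propDecidable _) hex 0 hacc)
  refine ⟨_, _, ?_, hgr⟩
  rw [DegreeAlgorithm.run, dif_pos hex, h0]

theorem theorem2 (F G : PMF ℕ) (μ α β δ₀ : ℝ) (L_F L_G : ℝ → ℝ)
    (hμ : 0 < μ) (hFμ : HasMean F μ) (hGμ : HasMean G μ)
    (hα : 1 < α) (hβ : 1 < β)
    (hL_F : IsSlowlyVarying L_F) (hL_G : IsSlowlyVarying L_G)
    (hF : HasPowerLawMajorant F α L_F) (hG : HasPowerLawMajorant G β L_G)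
    (hδ₀ : 0 < δ₀) (hδ₀κ : δ₀ < DegreeAlgorithm.kappa α β) :
    Tendsto
      (fun n : ℕ => DegreeAlgorithm.inputLaw F G n
        (DegreeAlgorithm.graphicalEvent (DegreeAlgorithm.kappa α β) δ₀ n))
      atTop (𝓝 1) := by
  set κ := DegreeAlgorithm.kappa α β with hκ
  have hκ1 : κ ≤ 1 - α⁻¹ := min_le_left _ _
  have hκ2 : κ ≤ 1 - β⁻¹ := (min_le_right _ _).trans (min_le_left _ _)
  have hκ3 : κ ≤ 1 / 2 := (min_le_right _ _).trans (min_le_right _ _)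
  set a := 1 - κ + δ₀ with ha
  have ha1 : 1 / 2 < a := by linarith
  have ha2 : a < 1 := by linarith
  -- The midpoint of `a` and 1 exceeds both `a` and 1/2; with `c` as below, b + c = (3 + a) / 4 < 1.
  set b := (1 + a) / 2 with hb
  set c := (1 - a) / 4 with hc
  have hF' := tendsto_pi_typicalSet (a := a) (c := c) hμ hFμ hL_F hF ha1 ha2
    (by linarith) (by linarith) (by linarith)
  have hG' := tendsto_pi_typicalSet (a := a) (c := c) hμ hGμ hL_G hG ha1 ha2
    (by linarith) (by linarith) (by linarith)
  have hFG := ENNReal.Tendsto.mul hF' (by simp) hG' (by simp)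
  rw [one_mul] at hFG
  refine tendsto_of_tendsto_of_tendsto_of_le_of_le' hFG tendsto_const_nhds ?_
    (Eventually.of_forall fun n => prob_le_one)
  filter_upwards [eventually_largeEnough (a := a) (b := b) (c := c) hμ (by linarith) ha2
    (by linarith) (by linarith) (by linarith) (by linarith)] with n hn
  rw [← Measure.prod_prod]
  exact sampleLaw_le_inputLaw_graphicalEvent F G fun s hs σ =>
    accepted_and_isGraphical_of_typical hn hs.1 hs.2 σ
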